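/- **Theorem (Adequacy).** Terms of the sequential $\lambda$-calculus are given, modulo $\alpha$-equivalence, by $M,N ::= * \mid x.M \mid [N].M \mid \langle x\rangle.M$ (where $\langle x\rangle$ binds $x$ in $M$). Composition is $*;M=M$, $(x.N);M=x.(N;M)$, $([P].N);M=[P].(N;M)$, $(\langle x\rangle.N);M=\langle x\rangle.(N;M)$ for $x$ not free in $M$; and $\{P/x\}M$ is capture-avoiding substitution, with $\{P/x\}(x.M)=P;\{P/x\}M$. A stack is a finite list $S ::= \varepsilon\mid S\cdot M$ of closed terms (top on the right). The machine acts on pairs $(S,M)$ of a stack and a closed term by the steps $$(S,[N].M)\to(S\cdot N,\,M),\qquad (S\cdot N,\langle x\rangle.M)\to(S,\{N/x\}M),$$ and $(S,M)\Downarrow(T,N)$ means that a finite (possibly empty) sequence of steps leads from $(S,M)$ to $(T,N)$. Let $TX=X_\bot$ be the lifting monad (with unit $\eta$) on the category of pointed $\omega$-complete partial orders and continuous functions, and let $D\cong(D^{\mathbb N}\to TD^{\mathbb N})$ be the canonical solution of this domain equation, that is, the bilimit of $D_0=\{\bot\}$, $D_{n+1}=(D_n^{\mathbb N}\to TD_n^{\mathbb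 N})$. For $s\in D^{\mathbb N}$ and $d\in D$ let $s\cdot d$ be $s$ with $d$ pushed on top (so $D^{\mathbb N}\cong D^{\mathbb N}\times D$), and let $d_1.d_2$ be Kleisli composition, first $d_1$, then $d_2$. Eliding the isomorphism, put for an environment $\rho$ $$[\![*]\!]\rho=\eta,\quad [\![x.M]\!]\rho=\rho(x).[\![M]\!]\rho,\quad [\![[N].M]\!]\rho\,s=[\![M]\!]\rho\,(s\cdot[\![N]\!]\rho),\quad [\![\langle x\rangle.M]\!]\rho\,(s\cdot d)=[\![M]\!](\rho[x\mapsto d])\,s,$$ and $[\![\varepsilon]\!]=\bot$, $[\![S\cdot M]\!]=[\![S]\!]\cdot[\![M]\!]$ in $D^{\mathbb N}$. Let $M$ be a closed term and $S$ a stack of closed terms that provides sufficient inputs for $M$, i.e. the machine run from $(S,M)$ never reaches a state $(\varepsilon,\langle x\rangle.N)$ in which it would have to pop the empty stack. If $[\![M]\!]([\![S]\!])\neq\bot$ in $TD^{\mathbb N}$, then there is a stack $T$ with $(S,M)\Downarrow(T,*)$. -/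

import Mathlib

namespace SeqLam

open OmegaCompletePartialOrder

/-! ## The sequential lambda-calculus -/

/-- Terms of the sequential lambda-calculus, `* | x.M | [N].M | <x>.M`, modulo alpha-equivalence:
`Term n` is the type of terms whose free variables are among `n` given ones (de Bruijn indices),
so `Term 0` is the type of closed terms. -/
inductive Term : ℕ → Type
  /-- the nil term `*` -/
  | nil {n : ℕ} : Term n
  /-- the sequential variable `x.M` -/
  | var {n : ℕ} (x : Fin n) (M : Term n) : Term n
  /-- the application (push) `[N].M` -/
  | push {n : ℕ} (N M : Term n) : Term n
  /-- the abstraction (pop) `<x>.M`; the bound variable has index `0` in `M` -/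
  | pop {n : ℕ} (M : Term (n + 1)) : Term n

namespace Term

/-- Renaming of free variables. -/
def rename : {n m : ℕ} → (Fin n → Fin m) → Term n → Term m
  | _, _, _, nil => nil
  | _, _, r, var x M => var (r x) (rename r M)
  | _, _, r, push N M => push (rename r N) (rename r M)
  | _, _, r, pop M => pop (rename (Fin.cases 0 fun i => (r i).succ) M)

/-- Sequential composition `N;M`. -/
def comp : {n : ℕ} → Term n → Term n → Term n
  | _, nil, M => M
  | _, var x N, M => var x (comp N M)
  | _, push P N, M => push P (comp N M)
  | _, pop N, M => pop (comp N (rename Fin.succ M))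

/-- Capture-avoiding simultaneous substitution. In particular `{P/x}x.M = P;{P/x}M`. -/
def subst : {n m : ℕ} → (Fin n → Term m) → Term n → Term m
  | _, _, _, nil => nil
  | _, _, s, var x M => comp (s x) (subst s M)
  | _, _, s, push N M => push (subst s N) (subst s M)
  | _, _, s, pop M => pop (subst (Fin.cases (var 0 nil) fun i => rename Fin.succ (s i)) M)

/-- `{N/x}M`, where `x` is the variable of index `0`. -/
def inst {n : ℕ} (N : Term n) (M : Term (n + 1)) : Term n :=
  subst (Fin.cases N fun i => var i nil) M

end Term

/-! ## The stack machine -/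

/-- Stacks of closed terms, `S ::= ε | S·M`; the top of the stack is the head of the list. -/
abbrev Stack : Type := List (Term 0)

/-- Machine states `(S, M)`, with all terms closed. -/
abbrev State : Type := Stack × Term 0

/-- The transitions of the machine. -/
inductive Step : State → State → Prop
  | push (S : Stack) (N M : Term 0) : Step (S, Term.push N M) (N :: S, M)
  | pop (S : Stack) (N : Term 0) (M : Term 1) : Step (N :: S, Term.pop M) (S, Term.inst N M)

/-- `Run (S, M) (T, N)`: there is a run of the machine, i.e. a finite (possibly empty) sequence of
steps, from `(S, M)` to `(T, N)`. -/
def Run : State → State → Prop := Relation.ReflTransGen Step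

/-- The stack `S` provides sufficient inputs for `M`: the machine run from `(S, M)` never attempts
to pop a term from the empty stack. -/
def SufficientInputs (S : Stack) (M : Term 0) : Prop :=
  ∀ N : Term 1, ¬ Run (S, M) ([], Term.pop N)

/-! ## The lifting monad

The underlying order of the lifting of `A` is `WithBot A`, with unit `a ↦ ↑a`. -/

section Lifting

variable {A B X : Type*} [OmegaCompletePartialOrder A] [OmegaCompletePartialOrder B]
  [OmegaCompletePartialOrder X]

/-- The proper part of an increasing sequence in `WithBot A`, from an index on at which
the sequence is not `⊥`. -/
def liftTail (c : Chain (WithBot A)) (i : ℕ) (hi : c i ≠ ⊥) : Chain A where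
  toFun n := (c (n + i)).unbot (ne_bot_of_le_ne_bot hi (c.monotone (Nat.le_add_left i n)))
  monotone' m n h := by
    rw [← WithBot.coe_le_coe, WithBot.coe_unbot, WithBot.coe_unbot]
    exact c.monotone (Nat.add_le_add_right h i)

theorem coe_liftTail (c : Chain (WithBot A)) (i : ℕ) (hi : c i ≠ ⊥) (n : ℕ) :
    (liftTail c i hi n : WithBot A) = c (n + i) :=
  WithBot.coe_unbot _ _

open Classical in
/-- The supremum of an increasing sequence in the lifting of `A`. -/
noncomputable def liftSup (c : Chain (WithBot A)) : WithBot A :=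
  if h : ∃ i, c i ≠ ⊥ then ↑(ωSup (liftTail c h.choose h.choose_spec)) else ⊥

noncomputable instance instCpoLift : OmegaCompletePartialOrder (WithBot A) where
  ωSup := liftSup
  le_ωSup c i := by
    unfold liftSup
    split_ifs with h
    · refine le_trans (b := c (i + h.choose)) (c.monotone (Nat.le_add_right i h.choose)) ?_
      rw [← coe_liftTail c _ h.choose_spec, WithBot.coe_le_coe]
      exact le_ωSup _ i
    · push Not at h
      exact (h i).le
  ωSup_le c x hx := by
    unfold liftSup
    split_ifs with h
    · have hb : x ≠ ⊥ := ne_bot_of_le_ne_bot h.choose_spec (hx _)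
      lift x to A using hb
      rw [WithBot.coe_le_coe]
      refine ωSup_le _ _ fun n => ?_
      rw [← WithBot.coe_le_coe, coe_liftTail]
      exact hx _
    · exact bot_le

/-- Kleisli extension for the lifting monad: `⊥` is sent to `⊥` and `↑a` to `g a`. -/
noncomputable def liftBind (w : WithBot A) (g : A →𝒄 WithBot B) : WithBot B :=
  WithBot.recBotCoe ⊥ g w

@[simp] theorem liftBind_bot (g : A →𝒄 WithBot B) : liftBind ⊥ g = ⊥ := rfl

@[simp] theorem liftBind_coe (a : A) (g : A →𝒄 WithBot B) : liftBind ↑a g = g a := rfl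

theorem liftBind_mono {w w' : WithBot A} {g g' : A →𝒄 WithBot B} (hw : w ≤ w') (hg : g ≤ g') :
    liftBind w g ≤ liftBind w' g' := by
  induction w with
  | bot => simp
  | coe a =>
    induction w' with
    | bot => simp at hw
    | coe a' => exact ContinuousHom.apply_mono hg (WithBot.coe_le_coe.1 hw)

@[fun_prop]
theorem continuous_liftBind {f : X → WithBot A} {g : X → A →𝒄 WithBot B}
    (hf : ωScottContinuous f) (hg : ωScottContinuous g) :
    ωScottContinuous fun x => liftBind (f x) (g x) := by
  have hm : Monotone fun x => liftBind (f x) (g x) :=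
    fun x y h => liftBind_mono (hf.monotone h) (hg.monotone h)
  refine ωScottContinuous.of_monotone_map_ωSup ⟨hm, fun c => le_antisymm ?_ ?_⟩
  · by_cases h : ∃ i, f (c i) ≠ ⊥
    · obtain ⟨i, hi⟩ := h
      set c' : Chain (WithBot A) := c.map ⟨f, hf.monotone⟩ with hc'
      have hi' : c' i ≠ ⊥ := hi
      have e : f (ωSup c) ≤ ↑(ωSup (liftTail c' i hi')) := by
        rw [hf.map_ωSup]
        refine ωSup_le _ _ fun n => ?_
        refine le_trans (b := c' (n + i)) (c'.monotone (Nat.le_add_right n i)) ?_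
        rw [← coe_liftTail c' i hi', WithBot.coe_le_coe]
        exact le_ωSup _ n
      refine le_trans (liftBind_mono e le_rfl) ?_
      rw [liftBind_coe, hg.map_ωSup, ContinuousHom.ωSup_apply_ωSup]
      rw [(ContinuousHom.Prod.apply (α := A) (β := WithBot B)).continuous]
      refine ωSup_le _ _ fun n => ?_
      have : (c.map ⟨_, hm⟩ : Chain (WithBot B)) (n + i) ≤ ωSup (c.map ⟨_, hm⟩) := le_ωSup _ _
      refine le_trans ?_ this
      change g (c n) (liftTail c' i hi' n) ≤ liftBind (f (c (n + i))) (g (c (n + i)))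
      have e2 : f (c (n + i)) = ↑(liftTail c' i hi' n) := (coe_liftTail c' i hi' n).symm
      rw [e2, liftBind_coe]
      exact hg.monotone (c.monotone (Nat.le_add_right n i)) _
    · push Not at h
      have : f (ωSup c) = ⊥ := by
        rw [hf.map_ωSup, eq_bot_iff]
        exact ωSup_le _ _ fun n => (h n).le
      rw [this]
      exact bot_le
  · exact ωSup_le _ _ fun n => hm (le_ωSup c n)

@[fun_prop]
theorem continuous_coe {f : X → A} (hf : ωScottContinuous f) :
    ωScottContinuous fun x => (f x : WithBot A) := by
  have hm : Monotone fun x => (f x : WithBot A) := fun x y h => WithBot.coe_le_coe.2 (hf.monotone h)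
  refine ωScottContinuous.of_monotone_map_ωSup ⟨hm, fun c => le_antisymm ?_ ?_⟩
  · set u := ωSup (c.map ⟨_, hm⟩ : Chain (WithBot A)) with hu
    have hle : ∀ n, (f (c n) : WithBot A) ≤ u := fun n => le_ωSup (c.map ⟨_, hm⟩) n
    have hb : u ≠ ⊥ := ne_bot_of_le_ne_bot WithBot.coe_ne_bot (hle 0)
    clear_value u
    lift u to A using hb
    rw [WithBot.coe_le_coe, hf.map_ωSup]
    exact ωSup_le _ _ fun n => WithBot.coe_le_coe.1 (hle n)
  · exact ωSup_le _ _ fun n => hm (le_ωSup c n)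

/-- A family of continuous functions that is pointwise continuous in the parameter is continuous
as a map into the function space. -/
@[fun_prop]
theorem continuous_ofFun {F : X → A → B} (h : ∀ x, ωScottContinuous (F x))
    (hF : ∀ a, ωScottContinuous fun x => F x a) :
    ωScottContinuous fun x => ContinuousHom.ofFun (F x) (h x) := by
  refine ωScottContinuous.of_monotone_map_ωSup
    ⟨fun x y hxy a => (hF a).monotone hxy, fun c => ?_⟩
  ext a
  exact (hF a).map_ωSup c

end Lifting

/-- The least element of a function space. -/
instance instOrderBotHom {A B : Type*} [OmegaCompletePartialOrder A] [OmegaCompletePartialOrder B] [OrderBot B] :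
    OrderBot (A →𝒄 B) where
  bot := ContinuousHom.const ⊥
  bot_le _ _ := bot_le

/-! ## The domain `D`

`D` is the canonical solution of `D ≅ (D^ℕ → T D^ℕ)`: the (bi)limit of the sequence of domains
`D₀ = {⊥}`, `Dₙ₊₁ = (Dₙ^ℕ → T Dₙ^ℕ)`. -/

/-- An object of the category of complete partial orders with least element. -/
structure Cppo where
  /-- the underlying type -/
  carrier : Type
  [cpo : OmegaCompletePartialOrder carrier]
  [bot : OrderBot carrier]

instance instCoeSortCppo : CoeSort Cppo Type := ⟨Cppo.carrier⟩

instance instCpoCppo (A : Cppo) : OmegaCompletePartialOrder A := A.cpo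

instance instOrderBotCppo (A : Cppo) : OrderBot A := A.bot

instance instCpoPUnit : OmegaCompletePartialOrder PUnit.{1} where
  ωSup _ := PUnit.unit
  le_ωSup _ _ := le_rfl
  ωSup_le _ _ _ := le_rfl

/-- The continuous functions `A^ℕ → T A^ℕ`, `T` being the lifting monad. -/
abbrev Trans (A : Type) [OmegaCompletePartialOrder A] : Type := (ℕ → A) →𝒄 WithBot (ℕ → A)

section Act

variable {A B C X : Type} [OmegaCompletePartialOrder A] [OmegaCompletePartialOrder B]
  [OmegaCompletePartialOrder C] [OmegaCompletePartialOrder X]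

/-- The action of `A ↦ (A^ℕ → T A^ℕ)` on maps, contravariant in the first argument `p` and
covariant in the second argument `e`. -/
noncomputable def act (p : B →𝒄 A) (e : A →𝒄 B) : Trans A →𝒄 Trans B :=
  ContinuousHom.ofFun (fun f => ContinuousHom.ofFun
    (fun s => liftBind (f fun i => p (s i))
      (ContinuousHom.ofFun (fun t => ((fun i => e (t i) : ℕ → B) : WithBot (ℕ → B))))))

theorem act_apply (p : B →𝒄 A) (e : A →𝒄 B) (f : Trans A) (s : ℕ → B) :
    act p e f s = liftBind (f fun i => p (s i))
      (ContinuousHom.ofFun (fun t => ((fun i => e (t i) : ℕ → B) : WithBot (ℕ → B)))) := rfl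

@[fun_prop]
theorem continuous_act {p : X → B →𝒄 A} {e : X → A →𝒄 B} {f : X → Trans A}
    (hp : ωScottContinuous p) (he : ωScottContinuous e) (hf : ωScottContinuous f) :
    ωScottContinuous fun x => act (p x) (e x) (f x) := by
  unfold act
  simp only [ContinuousHom.ofFun_apply]
  fun_prop

theorem act_id : act (ContinuousHom.id : A →𝒄 A) ContinuousHom.id = ContinuousHom.id := by
  ext f s : 2
  change liftBind (f s) _ = f s
  generalize f s = w
  induction w with
  | bot => rfl
  | coe t => rfl

theorem act_act (p : B →𝒄 A) (e : A →𝒄 B) (q : C →𝒄 B) (d : B →𝒄 C) (f : Trans A) :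
    act q d (act p e f) = act (p.comp q) (d.comp e) f := by
  ext s : 1
  simp only [act_apply]
  change liftBind (liftBind (f fun i => p (q (s i))) _) _ = liftBind (f fun i => p (q (s i))) _
  generalize (f fun i => p (q (s i))) = w
  induction w with
  | bot => rfl
  | coe t => rfl

theorem act_mono {p p' : B →𝒄 A} {e e' : A →𝒄 B} (hp : p ≤ p') (he : e ≤ e') (f : Trans A) :
    act p e f ≤ act p' e' f := by
  intro s
  refine liftBind_mono (f.monotone fun i => hp _) fun t => ?_
  exact WithBot.coe_le_coe.2 fun i => he _

theorem act_bot (p : B →𝒄 A) (e : A →𝒄 B) : act p e ⊥ = ⊥ := rfl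

end Act

/-- The approximating domains: `D₀ = {⊥}` and `Dₙ₊₁ = (Dₙ^ℕ → T Dₙ^ℕ)`. -/
noncomputable def Stage : ℕ → Cppo
  | 0 => ⟨PUnit⟩
  | n + 1 => ⟨Trans (Stage n)⟩

/-- The canonical maps between the approximating domains, in both directions: `⊥` if one of them is
`D₀`, and otherwise obtained by the functorial action from the maps one level below. -/
noncomputable def trPair : (m n : ℕ) → (Stage m →𝒄 Stage n) × (Stage n →𝒄 Stage m)
  | 0, _ => (ContinuousHom.const ⊥, ContinuousHom.const ⊥)
  | _ + 1, 0 => (ContinuousHom.const ⊥, ContinuousHom.const ⊥)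
  | m + 1, n + 1 =>
    (act (A := Stage m) (B := Stage n) (trPair m n).2 (trPair m n).1,
     act (A := Stage n) (B := Stage m) (trPair m n).1 (trPair m n).2)

/-- The canonical map `Dₘ → Dₙ`: an embedding if `m ≤ n`, a projection if `n ≤ m`. -/
noncomputable def tr (m n : ℕ) : Stage m →𝒄 Stage n := (trPair m n).1

theorem trPair_snd : ∀ m n : ℕ, (trPair m n).2 = tr n m
  | 0, 0 => rfl
  | 0, _ + 1 => rfl
  | _ + 1, 0 => rfl
  | m + 1, n + 1 => by
    change act (A := Stage n) (B := Stage m) (trPair m n).1 (trPair m n).2 =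
      act (A := Stage n) (B := Stage m) (trPair n m).2 (trPair n m).1
    rw [trPair_snd m n, trPair_snd n m]
    rfl
  termination_by m n => m + n

theorem tr_succ_succ (m n : ℕ) :
    tr (m + 1) (n + 1) = act (A := Stage m) (B := Stage n) (tr n m) (tr m n) := by
  rw [← trPair_snd m n]
  rfl

theorem tr_bot : ∀ m n : ℕ, tr m n ⊥ = ⊥
  | 0, _ => rfl
  | _ + 1, 0 => rfl
  | m + 1, n + 1 => by rw [tr_succ_succ]; rfl

theorem tr_self : ∀ n : ℕ, tr n n = ContinuousHom.id
  | 0 => rfl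
  | n + 1 => by rw [tr_succ_succ, tr_self n, act_id]; rfl

theorem tr_comp : ∀ (k m n : ℕ), (m ≤ k ∨ n ≤ k) → (tr k n).comp (tr m k) = tr m n
  | 0, m, n, h => by
    rcases h with h | h
    · obtain rfl : m = 0 := Nat.le_zero.1 h
      ext x
      exact tr_bot 0 n
    · obtain rfl : n = 0 := Nat.le_zero.1 h
      rfl
  | k + 1, 0, n, _ => by
    ext x
    exact tr_bot (k + 1) n
  | k + 1, m + 1, 0, _ => rfl
  | k + 1, m + 1, n + 1, h => by
    ext f
    change tr (k + 1) (n + 1) (tr (m + 1) (k + 1) f) = _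
    rw [tr_succ_succ, tr_succ_succ, tr_succ_succ, ← tr_comp k m n (by omega),
      ← tr_comp k n m (by omega)]
    exact act_act _ _ _ _ _

theorem tr_tr {k m n : ℕ} (h : m ≤ k ∨ n ≤ k) (x : Stage m) : tr k n (tr m k x) = tr m n x :=
  DFunLike.congr_fun (tr_comp k m n h) x

theorem tr_comp_le : ∀ (k m n : ℕ), (tr k n).comp (tr m k) ≤ tr m n
  | 0, m, n => fun _ => bot_le (α := Stage n)
  | k + 1, 0, n => (tr_comp (k + 1) 0 n (by omega)).le
  | k + 1, m + 1, 0 => le_rfl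
  | k + 1, m + 1, n + 1 => by
    intro f
    change tr (k + 1) (n + 1) (tr (m + 1) (k + 1) f) ≤ _
    rw [tr_succ_succ, tr_succ_succ, tr_succ_succ]
    refine (act_act _ _ _ _ _).trans_le ?_
    exact act_mono (tr_comp_le k n m) (tr_comp_le k m n) f

theorem tr_tr_le (k m n : ℕ) (x : Stage m) : tr k n (tr m k x) ≤ tr m n x :=
  tr_comp_le k m n x

/-- The compatible sequences of elements of the approximating domains. -/
def IsThread (x : ∀ n, Stage n) : Prop := ∀ n, tr (n + 1) n (x (n + 1)) = x n

/-- The domain `D`: the limit of the approximating domains along the projections. -/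
def D : Type := {x : ∀ n, Stage n // IsThread x}

noncomputable instance instCpoD : OmegaCompletePartialOrder D :=
  OmegaCompletePartialOrder.subtype IsThread fun c hc n => by
    change tr (n + 1) n (ωSup (c.map (Pi.evalOrderHom (n + 1)))) = ωSup (c.map (Pi.evalOrderHom n))
    rw [(tr (n + 1) n).continuous]
    congr 1
    ext i
    exact hc (c i) ⟨i, rfl⟩ n

noncomputable instance instOrderBotD : OrderBot D where
  bot := ⟨fun _ => ⊥, fun n => tr_bot (n + 1) n⟩
  bot_le _ _ := bot_le

/-- The projection `D → Dₙ`. -/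
noncomputable def proj (n : ℕ) : D →𝒄 Stage n where
  toFun x := x.1 n
  monotone' _ _ h := h n
  map_ωSup' _ := rfl

/-- The embedding `Dₙ → D`. -/
noncomputable def inj (n : ℕ) : Stage n →𝒄 D where
  toFun x := ⟨fun m => tr n m x, fun m => tr_tr (by omega) x⟩
  monotone' _ _ h m := (tr n m).monotone h
  map_ωSup' c := Subtype.ext (funext fun m => (tr n m).continuous c)

@[ext] theorem D.ext {x y : D} (h : ∀ n, proj n x = proj n y) : x = y := Subtype.ext (funext h)

theorem proj_inj (m n : ℕ) (x : Stage n) : proj m (inj n x) = tr n m x := rfl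

theorem tr_proj_succ (n : ℕ) (x : D) : tr (n + 1) n (proj (n + 1) x) = proj n x := x.2 n

theorem tr_proj {m n : ℕ} (h : n ≤ m) (x : D) : tr m n (proj m x) = proj n x := by
  induction m, h using Nat.le_induction with
  | base => rw [tr_self]; rfl
  | succ m h ih => rw [← ih, ← tr_proj_succ m, tr_tr (Or.inr h)]

theorem tr_proj_le (m n : ℕ) (x : D) : tr m n (proj m x) ≤ proj n x := by
  rcases le_total n m with h | h
  · exact (tr_proj h x).le
  · rw [← tr_proj h x]
    refine (tr_tr_le m n n _).trans ?_
    rw [tr_self]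
    exact le_rfl

theorem inj_tr {m n : ℕ} (h : n ≤ m) (x : Stage n) : inj m (tr n m x) = inj n x :=
  D.ext fun _ => tr_tr (Or.inl h) x

theorem inj_tr_le (m n : ℕ) (x : Stage n) : inj m (tr n m x) ≤ inj n x :=
  fun k => tr_tr_le m n k x

/-- The increasing sequence of the projections of `D` onto (the images of) the `Dₙ`. -/
noncomputable def retrChain : Chain (D →𝒄 D) where
  toFun n := (inj n).comp (proj n)
  monotone' := monotone_nat_of_le_succ fun n x => by
    change inj n (proj n x) ≤ inj (n + 1) (proj (n + 1) x)
    rw [← tr_proj_succ]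
    exact inj_tr_le n (n + 1) _

theorem ωSup_retrChain : ωSup retrChain = ContinuousHom.id := by
  refine le_antisymm (ωSup_le _ _ fun n x k => tr_proj_le n k x) fun x k => ?_
  have h : retrChain k x ≤ ωSup retrChain x := le_ωSup retrChain k x
  refine le_trans (b := proj k (retrChain k x)) ?_ (h k)
  change proj k x ≤ tr k k (proj k x)
  rw [tr_self]
  exact le_rfl

/-- The approximations of the isomorphism `D → (D^ℕ → T D^ℕ)`. -/
noncomputable def unfoldChain : Chain (D →𝒄 Trans D) where
  toFun n := (act (A := Stage n) (proj n) (inj n)).comp (proj (n + 1))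
  monotone' := monotone_nat_of_le_succ fun n x => by
    change act (A := Stage n) (proj n) (inj n) (proj (n + 1) x) ≤
      act (A := Stage (n + 1)) (proj (n + 1)) (inj (n + 1)) (proj (n + 2) x)
    rw [← tr_proj_succ (n + 1), tr_succ_succ]
    refine (act_act _ _ _ _ _).trans_le ?_
    exact act_mono (fun y => tr_proj_le n (n + 1) y) (fun y => inj_tr_le n (n + 1) y) _

/-- The isomorphism `D → (D^ℕ → T D^ℕ)`. -/
noncomputable def unfold : D →𝒄 Trans D := ωSup unfoldChain

/-- The components of the inverse isomorphism `(D^ℕ → T D^ℕ) → D`. -/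
noncomputable def foldStage : (n : ℕ) → Trans D →𝒄 Stage n
  | 0 => ContinuousHom.const ⊥
  | n + 1 => act (B := Stage n) (inj n) (proj n)

theorem isThread_foldStage (f : Trans D) : IsThread fun n => foldStage n f
  | 0 => rfl
  | n + 1 => by
    change tr (n + 2) (n + 1) (act (B := Stage (n + 1)) (inj (n + 1)) (proj (n + 1)) f) =
      act (B := Stage n) (inj n) (proj n) f
    rw [tr_succ_succ]
    refine (act_act _ _ _ _ _).trans ?_
    congr 2
    · ext1 y
      exact inj_tr (Nat.le_succ n) y
    · ext1 y
      exact tr_proj (Nat.le_succ n) y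

/-- The inverse isomorphism `(D^ℕ → T D^ℕ) → D`. -/
noncomputable def fold : Trans D →𝒄 D where
  toFun f := ⟨fun n => foldStage n f, isThread_foldStage f⟩
  monotone' _ _ h n := (foldStage n).monotone h
  map_ωSup' c := Subtype.ext (funext fun n => (foldStage n).continuous c)

theorem proj_fold (n : ℕ) (f : Trans D) :
    proj (n + 1) (fold f) = act (B := Stage n) (inj n) (proj n) f := rfl

theorem unfoldChain_fold (n : ℕ) (f : Trans D) :
    unfoldChain n (fold f) = act (retrChain n) (retrChain n) f :=
  act_act (A := D) (B := Stage n) (C := D) (inj n) (proj n) (proj n) (inj n) f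

theorem unfold_fold (f : Trans D) : unfold (fold f) = f := by
  have hc : ωScottContinuous fun h : D →𝒄 D => act h h f := by fun_prop
  have h := hc.map_ωSup retrChain
  rw [ωSup_retrChain, act_id] at h
  refine Eq.trans ?_ h.symm
  refine le_antisymm (ωSup_le _ _ ?_) (ωSup_le _ _ ?_)
  · rintro n
    refine (unfoldChain_fold n f).trans_le ?_
    exact le_ωSup (Chain.map retrChain ⟨_, hc.monotone⟩) n
  · rintro n
    refine (unfoldChain_fold n f).ge.trans ?_
    exact le_ωSup unfoldChain n (fold f)

theorem fold_unfold (x : D) : fold (unfold x) = x := by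
  have key : ∀ n k : ℕ, proj (n + 1) (fold (unfoldChain k x)) =
      tr (k + 1) (n + 1) (proj (k + 1) x) := fun n k => by
    rw [proj_fold, tr_succ_succ]
    exact act_act _ _ _ _ _
  have hs : ∀ n, proj (n + 1) (fold (unfold x)) = proj (n + 1) x := fun n => by
    have hc : ωScottContinuous fun g : D →𝒄 Trans D => proj (n + 1) (fold (g x)) := by fun_prop
    have h := hc.map_ωSup unfoldChain
    refine h.trans (le_antisymm (ωSup_le _ _ fun k => ?_) ?_)
    · exact (key n k).trans_le (tr_proj_le _ _ x)
    · refine le_trans ?_ (le_ωSup _ n)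
      exact ((key n n).trans (tr_proj le_rfl x)).ge
  ext n
  rw [← tr_proj_succ n, hs, tr_proj_succ]

/-- The isomorphism `D ≅ (D^ℕ → T D^ℕ)`. -/
noncomputable def isoD : D ≃o Trans D where
  toFun := unfold
  invFun := fold
  left_inv := fold_unfold
  right_inv := unfold_fold
  map_rel_iff' {x y} := by
    refine ⟨fun h => ?_, fun h => unfold.monotone h⟩
    rw [← fold_unfold x, ← fold_unfold y]
    exact fold.monotone h

/-! ## The semantics -/

/-- The stack `s·d` obtained by pushing `d` onto `s`; the top of the stack has index `0`. -/
def pushD (s : ℕ → D) (d : D) : ℕ → D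
  | 0 => d
  | i + 1 => s i

/-- The environment that sends the variable of index `0` to `d`, and the others as in `ρ`. -/
def extend {n : ℕ} (ρ : Fin n → D) (d : D) : Fin (n + 1) → D := Fin.cases d ρ

section Continuity

variable {X : Type*} [OmegaCompletePartialOrder X]

@[fun_prop]
theorem continuous_pushD {s : X → ℕ → D} {d : X → D} (hs : ωScottContinuous s)
    (hd : ωScottContinuous d) : ωScottContinuous fun x => pushD (s x) (d x) :=
  ωScottContinuous.of_apply₂ fun i => match i with
    | 0 => hd
    | i + 1 => hs.apply₂ i

@[fun_prop]
theorem continuous_extend {n : ℕ} {ρ : X → Fin n → D} {d : X → D} (hr : ωScottContinuous ρ)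
    (hd : ωScottContinuous d) : ωScottContinuous fun x => extend (ρ x) (d x) :=
  ωScottContinuous.of_apply₂ fun i => by
    induction i using Fin.cases with
    | zero => exact hd
    | succ i => exact hr.apply₂ i

end Continuity

/-- The unit `η` of the monad, as an element of `D`. -/
noncomputable def etaD : D := fold (ContinuousHom.ofFun fun s => (s : WithBot (ℕ → D)))

/-- The sequencing operation `d₁.d₂` of `D`: Kleisli composition, first `d₁` and then `d₂`. -/
noncomputable def seqD (d₁ d₂ : D) : D :=
  fold (ContinuousHom.ofFun fun s => liftBind (unfold d₁ s) (unfold d₂))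

@[fun_prop]
theorem continuous_seqD {X : Type*} [OmegaCompletePartialOrder X] {f g : X → D}
    (hf : ωScottContinuous f) (hg : ωScottContinuous g) :
    ωScottContinuous fun x => seqD (f x) (g x) := by
  unfold seqD
  fun_prop

/-- The denotation `⟦M⟧ρ` of a term, as a continuous function of the environment `ρ`:
* `⟦*⟧ρ = η`,
* `⟦x.M⟧ρ = ρ(x).⟦M⟧ρ`,
* `⟦[N].M⟧ρ s = ⟦M⟧ρ (s·⟦N⟧ρ)`,
* `⟦<x>.M⟧ρ (s·d) = ⟦M⟧(ρ[x ↦ d]) s`. -/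
noncomputable def sem : {n : ℕ} → Term n → (Fin n → D) →𝒄 D
  | _, Term.nil => ContinuousHom.const etaD
  | _, Term.var x M => ContinuousHom.ofFun fun ρ => seqD (ρ x) (sem M ρ)
  | _, Term.push N M => ContinuousHom.ofFun fun ρ =>
      fold (ContinuousHom.ofFun fun s => unfold (sem M ρ) (pushD s (sem N ρ)))
  | _, Term.pop M => ContinuousHom.ofFun fun ρ =>
      fold (ContinuousHom.ofFun fun s => unfold (sem M (extend ρ (s 0))) fun i => s (i + 1))

/-- The denotation `⟦M⟧` of a closed term. -/
noncomputable def semClosed (M : Term 0) : D := sem M Fin.elim0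

/-- The denotation of a stack of closed terms: `⟦ε⟧ = ⊥` and `⟦S·M⟧ = ⟦S⟧·⟦M⟧`. -/
noncomputable def semStack : Stack → ℕ → D
  | [] => ⊥
  | M :: S => pushD (semStack S) (semClosed M)

end SeqLam

namespace SeqLam

open OmegaCompletePartialOrder

/-! ## Renaming, composition and substitution -/

namespace Term

/-! The proof uses a logical relation between `D` and closed terms. An element `d` approximates `M`
if, whenever a stream `s` approximates a stack `S` and `d` maps `s` to a proper value `t`, the run
from `(S, M)` either gets stuck popping the empty stack or ends in some `(T, *)` with `T`
approximated by `t`. As a definition on `D` this is circular, with both positive and negative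
occurrences. It is therefore made by recursion on the stages `Dₙ`, and `rel` requires it of all
projections. The canonical maps preserve the relation in both directions (`stageRel_tr`) and it is
closed under suprema of chains (`admissible_stageRel`), so `rel` satisfies the circular clause
(`transRel_unfold`, `rel_fold`). Induction on terms (`rel_sem`) then shows that every closed term is
approximated by its denotation. Sufficiency of inputs excludes the stuck alternative. -/

theorem rename_rename {n m k : ℕ} (q : Fin n → Fin m) (r : Fin m → Fin k) (M : Term n) :
    rename r (rename q M) = rename (r ∘ q) M := by
  induction M generalizing m k with
  | nil => rfl
  | var x M ih => simp [rename, ih]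
  | push N M ihN ihM => simp [rename, ihN, ihM]
  | pop M ih =>
    simp only [rename, ih]
    congr 2
    ext i
    induction i using Fin.cases <;> simp

theorem rename_succ_rename {n m : ℕ} (r : Fin n → Fin m) (M : Term n) :
    rename (Fin.cases 0 fun i => (r i).succ) (rename Fin.succ M) =
      rename Fin.succ (rename r M) := by
  rw [rename_rename, rename_rename]
  rfl

theorem rename_comp {n m : ℕ} (r : Fin n → Fin m) (N M : Term n) :
    rename r (comp N M) = comp (rename r N) (rename r M) := by
  induction N generalizing m with
  | nil => rfl
  | var x N ih => simp [rename, comp, ih]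
  | push P N _ ih => simp [rename, comp, ih]
  | pop N ih => simp only [rename, comp, ih, rename_succ_rename]

@[simp] theorem comp_nil {n : ℕ} (M : Term n) : comp M nil = M := by
  induction M with
  | nil => rfl
  | var x N ih => simp [comp, ih]
  | push P N _ ih => simp [comp, ih]
  | pop N ih => simp [comp, rename, ih]

theorem comp_assoc {n : ℕ} (L M N : Term n) : comp (comp L M) N = comp L (comp M N) := by
  induction L with
  | nil => rfl
  | var x L ih => simp [comp, ih]
  | push P L _ ih => simp [comp, ih]
  | pop L ih => simp [comp, ih, rename_comp]

theorem subst_rename {n m k : ℕ} (r : Fin n → Fin m) (s : Fin m → Term k) (M : Term n) :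
    subst s (rename r M) = subst (s ∘ r) M := by
  induction M generalizing m k with
  | nil => rfl
  | var x M ih => simp [rename, subst, ih]
  | push N M ihN ihM => simp [rename, subst, ihN, ihM]
  | pop M ih =>
    simp only [rename, subst, ih]
    congr 2
    ext i
    induction i using Fin.cases <;> simp

theorem rename_subst {n m k : ℕ} (s : Fin n → Term m) (r : Fin m → Fin k) (M : Term n) :
    rename r (subst s M) = subst (fun i => rename r (s i)) M := by
  induction M generalizing m k with
  | nil => rfl
  | var x M ih => simp [subst, rename_comp, ih]
  | push N M ihN ihM => simp [rename, subst, ihN, ihM]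
  | pop M ih =>
    simp only [rename, subst, ih]
    congr 2
    ext i
    induction i using Fin.cases with
    | zero => rfl
    | succ i => exact rename_succ_rename r (s i)

theorem subst_rename_succ {n m : ℕ} (s : Fin n → Term m) (M : Term n) :
    subst (Fin.cases (var 0 nil) fun i => rename Fin.succ (s i)) (rename Fin.succ M) =
      rename Fin.succ (subst s M) := by
  rw [subst_rename, rename_subst]
  rfl

/-- Substituting for a variable itself produces a composition, so the variable case rests on
associativity. -/
theorem subst_comp {n m : ℕ} (s : Fin n → Term m) (N M : Term n) :
    subst s (comp N M) = comp (subst s N) (subst s M) := by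
  induction N generalizing m with
  | nil => rfl
  | var x N ih => simp [subst, comp, ih, comp_assoc]
  | push P N _ ih => simp [subst, comp, ih]
  | pop N ih => simp only [subst, comp, ih, subst_rename_succ]

theorem subst_subst {n m k : ℕ} (q : Fin n → Term m) (s : Fin m → Term k) (M : Term n) :
    subst s (subst q M) = subst (fun i => subst s (q i)) M := by
  induction M generalizing m k with
  | nil => rfl
  | var x M ih => simp [subst, subst_comp, ih]
  | push N M ihN ihM => simp [subst, ihN, ihM]
  | pop M ih =>
    simp only [subst, ih]
    congr 2
    ext i
    induction i using Fin.cases with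
    | zero => rfl
    | succ i => exact subst_rename_succ s (q i)

theorem subst_var {n : ℕ} (M : Term n) : subst (fun i => var i nil) M = M := by
  induction M with
  | nil => rfl
  | var x M ih => simp [subst, comp, ih]
  | push N M ihN ihM => simp [subst, ihN, ihM]
  | @pop n M ih =>
    simp only [subst]
    have : (Fin.cases (var 0 nil) fun i : Fin n => rename Fin.succ (var i nil) :
        Fin (n + 1) → Term (n + 1)) = fun i => var i nil := by
      ext i
      induction i using Fin.cases <;> rfl
    rw [this, ih]

theorem inst_rename_succ {n : ℕ} (N M : Term n) : inst N (rename Fin.succ M) = M := by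
  rw [inst, subst_rename]
  exact subst_var M

/-- Popping `N` after substituting under the binder amounts to one substitution extended by `N`;
this matches `extend` on environments. -/
theorem inst_subst {n m : ℕ} (s : Fin n → Term m) (N : Term m) (M : Term (n + 1)) :
    inst N (subst (Fin.cases (var 0 nil) fun i => rename Fin.succ (s i)) M) =
      subst (Fin.cases N s) M := by
  rw [inst, subst_subst]
  congr 1
  ext i
  induction i using Fin.cases with
  | zero => exact comp_nil N
  | succ i => exact inst_rename_succ N (s i)

theorem inst_comp {n : ℕ} (P : Term n) (N : Term (n + 1)) (M : Term n) :
    inst P (comp N (rename Fin.succ M)) = comp (inst P N) M := by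
  rw [inst, subst_comp]
  exact congrArg _ (inst_rename_succ P M)

end Term

/-! ## Runs of the machine -/

theorem Step.comp {S T : Stack} {N N' : Term 0} (M : Term 0) (h : Step (S, N) (T, N')) :
    Step (S, N.comp M) (T, N'.comp M) := by
  cases h with
  | push => exact Step.push _ _ _
  | pop S P N =>
    rw [← Term.inst_comp]
    exact Step.pop _ _ _

/-- A continuation `M` is inert while the first component runs, and takes over once that component
has become `*`. -/
theorem Run.comp {a b : State} (M : Term 0) (h : Run a b) :
    Run (a.1, a.2.comp M) (b.1, b.2.comp M) :=
  Relation.ReflTransGen.lift (fun a : State => ((a.1, a.2.comp M) : State))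
    (fun _ _ => Step.comp M) _ _ h

theorem Step.rightUnique : Relator.RightUnique Step := by
  intro a b c hb hc
  cases hb <;> cases hc <;> rfl

/-- By determinism one of the two runs extends the other, and nothing can be run after `*`. -/
theorem Run.nil_unique {a : State} {T T' : Stack} (h : Run a (T, Term.nil))
    (h' : Run a (T', Term.nil)) : T = T' := by
  rcases Relation.ReflTransGen.total_of_right_unique Step.rightUnique h h' with h | h <;>
    rcases h.cases_head with h | ⟨_, h, _⟩
  · exact congrArg Prod.fst h
  · cases h
  · exact (congrArg Prod.fst h).symm
  · cases h

/-- The run from `a` either tries to pop from the empty stack, or it terminates with a stack that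
satisfies `P`. -/
def Converges (a : State) (P : Stack → Prop) : Prop :=
  (∃ N, Run a ([], Term.pop N)) ∨ ∃ T, Run a (T, Term.nil) ∧ P T

theorem Converges.imp {a : State} {P Q : Stack → Prop} (h : Converges a P)
    (hPQ : ∀ T, P T → Q T) : Converges a Q :=
  Or.imp_right (fun ⟨T, hr, hT⟩ => ⟨T, hr, hPQ T hT⟩) h

theorem Converges.of_run {a b : State} {P : Stack → Prop} (h : Converges b P) (hr : Run a b) :
    Converges a P :=
  Or.imp (fun ⟨N, h⟩ => ⟨N, hr.trans h⟩) (fun ⟨T, h, hT⟩ => ⟨T, hr.trans h, hT⟩) h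

/-- Operational counterpart of Kleisli composition. A stuck run remains stuck, because composing a
pop with `M` gives a pop again. -/
theorem Converges.comp {S : Stack} {N M : Term 0} {P Q : Stack → Prop}
    (h : Converges (S, N) P) (hM : ∀ T, P T → Converges (T, M) Q) :
    Converges (S, N.comp M) Q := by
  rcases h with ⟨L, hL⟩ | ⟨T, hT, hP⟩
  · exact Or.inl ⟨_, hL.comp M⟩
  · exact (hM T hP).of_run (hT.comp M)

/-! ## The approximation relation -/

section Relations

variable {A B : Type} {R : A → Term 0 → Prop} {R' : B → Term 0 → Prop}

/-- A stream approximates a stack if this holds for the entries that the stack has. -/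
def StackRel (R : A → Term 0 → Prop) (s : ℕ → A) (S : Stack) : Prop :=
  ∀ (i : ℕ) (h : i < S.length), R (s i) S[i]

theorem StackRel.map {s : ℕ → A} {S : Stack} (h : StackRel R s S) (e : A → B)
    (he : ∀ x M, R x M → R' (e x) M) : StackRel R' (fun i => e (s i)) S :=
  fun i hi => he _ _ (h i hi)

/-- `f` approximates `M` if it maps approximations of stacks to approximations of the results of
running `M` on them. -/
def TransRel [OmegaCompletePartialOrder A] (R : A → Term 0 → Prop) (f : Trans A) (M : Term 0) :
    Prop :=
  ∀ s S, StackRel R s S → ∀ t : ℕ → A, f s = ↑t → Converges (S, M) (StackRel R t)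

variable [OmegaCompletePartialOrder A] [OmegaCompletePartialOrder B]

/-- Inputs are pulled back along `p` and outputs pushed forward along `e`, hence the opposite
directions of the two hypotheses. -/
theorem TransRel.act {f : Trans A} {M : Term 0} (h : TransRel R f M) {p : B →𝒄 A} {e : A →𝒄 B}
    (hp : ∀ x M, R' x M → R (p x) M) (he : ∀ x M, R x M → R' (e x) M) :
    TransRel R' (act p e f) M := by
  intro s S hs t ht
  rw [act_apply] at ht
  have key := h _ S (hs.map p hp)
  generalize (f fun i => p (s i)) = w at ht key
  induction w with
  | bot => exact absurd ht.symm WithBot.coe_ne_bot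
  | coe u =>
    obtain rfl : (fun i => e (u i)) = t := WithBot.coe_injective ht
    exact (key u rfl).imp fun T hT => hT.map e he

/-- Relations that are closed under suprema of increasing sequences. -/
def Admissible (R : A → Term 0 → Prop) : Prop :=
  ∀ (M : Term 0) (c : Chain A), (∀ i, R (c i) M) → R (ωSup c) M

theorem Admissible.converges (hR : Admissible R) {a : State} (c : Chain (WithBot (ℕ → A)))
    (hc : ∀ i (t : ℕ → A), c i = ↑t → Converges a (StackRel R t)) {t : ℕ → A}
    (ht : ωSup c = ↑t) : Converges a (StackRel R t) := by
  -- The stuck alternative does not depend on `t`, so it is decided once for the whole chain. If it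
  -- fails, every proper member of the chain yields a terminating run.
  by_cases hN : ∃ N, Run a ([], Term.pop N)
  · exact Or.inl hN
  change liftSup c = _ at ht
  unfold liftSup at ht
  split_ifs at ht with h
  · obtain rfl := WithBot.coe_injective ht
    have hc' := fun n => (hc _ _ (coe_liftTail c _ h.choose_spec n).symm).resolve_left hN
    -- Each member of the chain provides its own final stack; by determinism they all coincide with
    -- this one, so admissibility of `R` applies entry by entry.
    obtain ⟨T, hT, -⟩ := hc' 0
    refine Or.inr ⟨T, hT, fun i hi => hR _ _ fun n => ?_⟩
    obtain ⟨T', hT', hr⟩ := hc' n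
    obtain rfl := hT.nil_unique hT'
    exact hr i hi
  · exact absurd ht.symm WithBot.coe_ne_bot

/-- Suprema of functions are pointwise: for a fixed input only the chain of outputs matters. -/
theorem Admissible.trans (hR : Admissible R) : Admissible (TransRel R) := by
  intro M c hc s S hs t ht
  exact hR.converges (c.map ⟨fun f : Trans A => f s, fun _ _ h => h s⟩)
    (fun i t ht => hc i s S hs t ht) ht

end Relations

/-! ### The relation on the stages and on their limit -/

/-- The approximation relation between the elements of `Dₙ` and closed terms. -/
def stageRel : (n : ℕ) → Stage n → Term 0 → Prop
  | 0 => fun _ _ => True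
  | n + 1 => TransRel (A := Stage n) (stageRel n)

theorem stageRel_bot : ∀ (n : ℕ) (M : Term 0), stageRel n ⊥ M
  | 0, _ => trivial
  | _ + 1, _ => fun _ _ _ _ ht => absurd ht.symm WithBot.coe_ne_bot

/-- Embeddings and projections must be treated together: the map from level `m + 1` to `n + 1` uses
the maps between `m` and `n` in both directions. The recursion is therefore on `m + n`. -/
theorem stageRel_tr : ∀ (m n : ℕ) (x : Stage m) (M : Term 0),
    stageRel m x M → stageRel n (tr m n x) M
  | 0, n, _, M, _ => stageRel_bot n M
  | _ + 1, 0, _, _, _ => trivial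
  | m + 1, n + 1, x, M, h => by
    rw [tr_succ_succ]
    exact TransRel.act h (stageRel_tr n m) (stageRel_tr m n)
  termination_by m n => m + n

theorem admissible_stageRel : ∀ n : ℕ, Admissible (stageRel n)
  | 0 => fun _ _ _ => trivial
  | n + 1 => (admissible_stageRel n).trans

/-- The approximation relation between the elements of `D` and closed terms. -/
def rel (d : D) (M : Term 0) : Prop := ∀ n, stageRel n (proj n d) M

theorem admissible_rel : Admissible rel := by
  intro M c hc n
  rw [(proj n).continuous]
  exact admissible_stageRel n M _ fun i => hc i n

theorem rel_inj (n : ℕ) (x : Stage n) (M : Term 0) (h : stageRel n x M) : rel (inj n x) M :=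
  fun m => stageRel_tr n m x M h

/-- `unfold d` is the supremum of the `(n + 1)`-st projections of `d`, transported from `Dₙ` to `D`;
each of these satisfies the clause, and admissibility passes it to the limit. -/
theorem transRel_unfold {d : D} {M : Term 0} (h : rel d M) : TransRel rel (unfold d) M :=
  admissible_rel.trans M (unfoldChain.map ⟨fun g : D →𝒄 Trans D => g d, fun _ _ h => h d⟩) fun n =>
    TransRel.act (A := Stage n) (h (n + 1)) (fun _ _ h => h n) (rel_inj n)

theorem rel_fold {f : Trans D} {M : Term 0} (h : TransRel rel f M) : rel (fold f) M
  | 0 => trivial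
  | n + 1 => TransRel.act (B := Stage n) h (rel_inj n) fun _ _ h => h n

/-! ## Adequacy -/

theorem stackRel_pushD {s : ℕ → D} {S : Stack} {d : D} {M : Term 0} (hs : StackRel rel s S)
    (hd : rel d M) : StackRel rel (pushD s d) (M :: S)
  | 0, _ => hd
  | i + 1, h => hs i (Nat.lt_of_succ_lt_succ h)

/-- The fundamental lemma of the logical relation, stated for open terms under related environments
and substitutions so that the induction passes through binders. -/
theorem rel_sem {n : ℕ} (M : Term n) (ρ : Fin n → D) (σ : Fin n → Term 0)
    (h : ∀ i, rel (ρ i) (σ i)) : rel (sem M ρ) (Term.subst σ M) := by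
  induction M with
  | nil =>
    refine rel_fold fun s S hs t ht => Or.inr ⟨S, Relation.ReflTransGen.refl, ?_⟩
    obtain rfl : s = t := WithBot.coe_injective ht
    exact hs
  | var x M ih =>
    refine rel_fold fun s S hs t ht => ?_
    change liftBind (unfold (ρ x) s) (unfold (sem M ρ)) = _ at ht
    have key := transRel_unfold (h x) s S hs
    generalize unfold (ρ x) s = w at ht key
    induction w with
    | bot => exact absurd ht.symm WithBot.coe_ne_bot
    | coe u =>
      exact (key u rfl).comp fun T hT => transRel_unfold (ih ρ σ h) u T hT t ht
  | push N M ihN ihM =>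
    refine rel_fold fun s S hs t ht => ?_
    exact (transRel_unfold (ihM ρ σ h) _ _ (stackRel_pushD hs (ihN ρ σ h)) t ht).of_run
      (Relation.ReflTransGen.single (Step.push _ _ _))
  | pop M ih =>
    refine rel_fold fun s S hs t ht => ?_
    cases S with
    -- The stuck alternative originates here: the denotation goes on with whatever `s 0` is, while
    -- the machine has nothing to pop.
    | nil => exact Or.inl ⟨_, Relation.ReflTransGen.refl⟩
    | cons N S =>
      have hρ : ∀ i, rel (extend ρ (s 0) i) (Fin.cases N σ i : Term 0) := fun i => by
        induction i using Fin.cases with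
        | zero => exact hs 0 (Nat.succ_pos _)
        | succ i => exact h i
      have hS : StackRel rel (fun i => s (i + 1)) S := fun i hi => hs (i + 1) (Nat.succ_lt_succ hi)
      refine (transRel_unfold (ih _ _ hρ) _ S hS t ht).of_run (Relation.ReflTransGen.single ?_)
      rw [← Term.inst_subst]
      exact Step.pop _ _ _

theorem rel_semClosed (M : Term 0) : rel (semClosed M) M := by
  -- There are no variables, so any substitution would do; the identity one is removed by
  -- `subst_var`.
  have h := rel_sem M Fin.elim0 (fun i => Term.var i Term.nil) fun i => i.elim0
  rwa [Term.subst_var] at h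

/-- The `⊥` entries below the bottom of the stack are harmless, since `StackRel` constrains only
positions that the stack has. -/
theorem stackRel_semStack : ∀ S : Stack, StackRel rel (semStack S) S
  | [] => fun _ h => absurd h (Nat.not_lt_zero _)
  | M :: S => stackRel_pushD (stackRel_semStack S) (rel_semClosed M)

end SeqLam

theorem mainTheorem5 (S : SeqLam.Stack) (M : SeqLam.Term 0)
    (hS : SeqLam.SufficientInputs S M)
    (h : SeqLam.unfold (SeqLam.semClosed M) (SeqLam.semStack S) ≠ ⊥) :
    ∃ T : SeqLam.Stack, SeqLam.Run (S, M) (T, SeqLam.Term.nil) := by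
  obtain ⟨t, ht⟩ := WithBot.ne_bot_iff_exists.1 h
  rcases SeqLam.transRel_unfold (SeqLam.rel_semClosed M) _ S (SeqLam.stackRel_semStack S) t ht.symm
    with ⟨N, hN⟩ | ⟨T, hT, -⟩
  · exact absurd hN (hS N)
  · exact ⟨T, hT⟩
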